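/- Let $n,p\in\mathbb{N}_0$, $D\ge 0$, and let $\bar F$ be a (possibly only partially defined) map from $\mathbb{R}^n\times\mathbb{R}^p\times\mathbb{R}$ to $\mathbb{R}^n$. Consider the discrete-time system $$x_{k+1}=\bar F(x_k,d_k,T_k),\qquad k\in\mathbb{N}_0,\qquad\qquad (\ast)$$ where $\{d_i\}\in\mathcal D:=\{\{d_i\}_{i\ge0}\subset\mathbb{R}^p: |d_i|\le D\ \forall i\}$. For $T>0$ let $\Phi(T)$ be the set of all real sequences $\{T_i\}_{i\ge0}$ with $T_i\in(0,T)$ for all $i$. Here $|\cdot|$ is the Euclidean norm, $\sum_{i=0}^{-1}T_i=0$, and any claim about $x_k$ or about $\bar F(x,d,T)$ includes that this value is defined. A function $\alpha:\mathbb{R}_{\ge0}\to\mathbb{R}_{\ge0}$ is of class $\mathcal K$ if it is continuous, strictly increasing and $\alpha(0)=0$, and of class $\mathcal K_\infty$ if moreover it is unbounded. A function $\beta:\mathbb{R}_{\ge0}\times\mathbb{R}_{\ge0}\to\mathbb{R}_{\ge0}$ is of class $\mathcal{KL}$ if $\beta(\cdot,t)\in\mathcal K$ for every $t\ge0$, $\beta(s,\cdot)$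 is strictly decreasing for every $s>0$, and $\lim_{t\to\infty}\beta(s,t)=0$ for every $s\ge0$. Then the following statements are equivalent. 1. The system $(\ast)$ is robustly semiglobally stable under varying sampling rate (RSS-VSR): there exists $\beta\in\mathcal{KL}$ such that for every $M\ge0$ there exists $T^\blacktriangle=T^\blacktriangle(M)>0$ such that the solutions of $(\ast)$ satisfy $$|x_k|\le\beta\Big(|x_0|,\sum_{i=0}^{k-1}T_i\Big)$$ for all $k\in\mathbb{N}_0$, $\{T_i\}\in\Phi(T^\blacktriangle)$, $|x_0|\le M$ and $\{d_i\}\in\mathcal D$. 2. There exists a function $\delta:(0,\infty)\to(0,\infty)$ such that for every $M\ge0$ there exists $T^\blacktriangle=T^\blacktriangle(M)>0$ so that - (i) for all $\epsilon>0$, the solutions of $(\ast)$ with $|x_0|\le\min\{\delta(\epsilon),M\}$, $\{T_i\}\in\Phi(T^\blacktriangle)$ and $\{d_i\}\in\mathcal D$ satisfy $|x_k|\le\epsilon$ for all $k\in\mathbb{N}_0$; - (ii) for all $L\ge0$ there exists $C=C(M,L)\ge0$ such that the solutions of $(\ast)$ with $|x_0|\le M$, $\{T_i\}\in\Phi(T^\blacktriangle)$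 and $\{d_i\}\in\mathcal D$ satisfy $|x_k|\le C$ for all $k\in\mathbb{N}_0$ for which $\sum_{i=0}^{k-1}T_i\le L$; - (iii) for all $\epsilon>0$ there exists $\mathcal T=\mathcal T(M,\epsilon)\ge0$ such that the solutions of $(\ast)$ with $|x_0|\le M$, $\{T_i\}\in\Phi(T^\blacktriangle)$ and $\{d_i\}\in\mathcal D$ satisfy $|x_k|\le\epsilon$ for all $k\in\mathbb{N}_0$ for which $\sum_{i=0}^{k-1}T_i\ge\mathcal T$. 3. There exist $\alpha_1,\alpha_2,\alpha_3\in\mathcal K_\infty$ such that for every $M\ge0$ there exist $T^*=T^*(M)>0$ and $V_M:\mathbb{R}^n\to\mathbb{R}_{\ge0}\cup\{\infty\}$ such that $$\alpha_1(|x|)\le V_M(x)\quad\forall x\in\mathbb{R}^n,\qquad V_M(x)\le\alpha_2(|x|)\quad\forall\,|x|\le M,$$ and $$V_M(\bar F(x,d,T))-V_M(x)\le -T\,\alpha_3(|x|)$$ for all $|x|\le M$, $|d|\le D$ and $T\in(0,T^*)$. -/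

import Mathlib

open Filter Topology
open scoped ENNReal

/-- Class `K` functions `ℝ≥0 → ℝ≥0`, written as real functions of which only the
restriction to `[0, ∞)` matters (nonnegativity there follows from the fields). -/
structure IsClassK (α : ℝ → ℝ) : Prop where
  continuousOn : ContinuousOn α (Set.Ici 0)
  strictMonoOn : StrictMonoOn α (Set.Ici 0)
  map_zero : α 0 = 0

/-- Class `K∞`: unbounded class `K` functions. -/
structure IsClassKInf (α : ℝ → ℝ) : Prop extends IsClassK α where
  unbounded : ∀ C : ℝ, ∃ s : ℝ, 0 ≤ s ∧ C < α s

/-- Class `KL`. Strict decrease in the second argument is asked for `s > 0` only, since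
`β 0 t = 0` for all `t ≥ 0`. -/
structure IsClassKL (β : ℝ → ℝ → ℝ) : Prop where
  isClassK : ∀ t : ℝ, 0 ≤ t → IsClassK (fun s => β s t)
  strictAntiOn : ∀ s : ℝ, 0 < s → StrictAntiOn (β s) (Set.Ici 0)
  tendsto_zero : ∀ s : ℝ, 0 ≤ s → Tendsto (β s) atTop (𝓝 0)

/-- `Φ(T)`: the sequences of sampling periods with values in the open interval `(0, T)`. -/
def samplingSeqs (T : ℝ) : Set (ℕ → ℝ) := {τ | ∀ i, τ i ∈ Set.Ioo 0 T}

/-- The disturbance sequences in `ℝᵖ` bounded by `D`. -/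
def disturbanceSeqs (p : ℕ) (D : ℝ) : Set (ℕ → EuclideanSpace ℝ (Fin p)) :=
  {d | ∀ i, ‖d i‖ ≤ D}

/-- A discrete-time model `x⁺ = F(x, d, T)` with state in `ℝⁿ` and disturbance in `ℝᵖ`. The right
hand side need not be defined everywhere (an exact discrete-time model of a continuous-time system
is undefined past a finite escape time), hence a partial function. -/
abbrev DTModel (n p : ℕ) : Type :=
  EuclideanSpace ℝ (Fin n) → EuclideanSpace ℝ (Fin p) → ℝ → Part (EuclideanSpace ℝ (Fin n))

namespace DTModel

variable {n p : ℕ}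

/-- The solution `x_k` at step `k` of `x_{k+1} = F(x_k, d_k, T_k)` from `x₀`, if it is defined. -/
def solution (F : DTModel n p) (x₀ : EuclideanSpace ℝ (Fin n))
    (d : ℕ → EuclideanSpace ℝ (Fin p)) (T : ℕ → ℝ) : ℕ → Part (EuclideanSpace ℝ (Fin n))
  | 0 => Part.some x₀
  | k + 1 => (solution F x₀ d T k).bind fun x => F x (d k) (T k)

/-- The solution from `x₀` is defined at step `k` and satisfies `|x_k| ≤ b`. -/
def SolutionBound (F : DTModel n p) (x₀ : EuclideanSpace ℝ (Fin n))
    (d : ℕ → EuclideanSpace ℝ (Fin p)) (T : ℕ → ℝ) (k : ℕ) (b : ℝ) : Prop :=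
  ∃ x ∈ F.solution x₀ d T k, ‖x‖ ≤ b

/-- Robust semiglobal stability under varying sampling rate. -/
def IsRSSVSR (F : DTModel n p) (D : ℝ) : Prop :=
  ∃ β : ℝ → ℝ → ℝ, IsClassKL β ∧
    ∀ M : ℝ, 0 ≤ M → ∃ Tmax : ℝ, 0 < Tmax ∧
      ∀ (k : ℕ), ∀ T ∈ samplingSeqs Tmax, ∀ x₀ : EuclideanSpace ℝ (Fin n), ‖x₀‖ ≤ M →
        ∀ d ∈ disturbanceSeqs p D,
          F.SolutionBound x₀ d T k (β ‖x₀‖ (∑ i ∈ Finset.range k, T i))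

/-- The semiglobal `ε`-`δ` characterization: uniform stability (with `δ` a function of `ε` only,
not of `M`), uniform boundedness over bounded elapsed time, and uniform attractivity. -/
def IsSemiglobalEpsDelta (F : DTModel n p) (D : ℝ) : Prop :=
  ∃ δ : ℝ → ℝ, (∀ ε : ℝ, 0 < ε → 0 < δ ε) ∧
    ∀ M : ℝ, 0 ≤ M → ∃ Tmax : ℝ, 0 < Tmax ∧
      (∀ ε : ℝ, 0 < ε →
        ∀ x₀ : EuclideanSpace ℝ (Fin n), ‖x₀‖ ≤ min (δ ε) M →
          ∀ T ∈ samplingSeqs Tmax, ∀ d ∈ disturbanceSeqs p D,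
            ∀ k : ℕ, F.SolutionBound x₀ d T k ε) ∧
      (∀ L : ℝ, 0 ≤ L → ∃ C : ℝ, 0 ≤ C ∧
        ∀ x₀ : EuclideanSpace ℝ (Fin n), ‖x₀‖ ≤ M →
          ∀ T ∈ samplingSeqs Tmax, ∀ d ∈ disturbanceSeqs p D,
            ∀ k : ℕ, ∑ i ∈ Finset.range k, T i ≤ L → F.SolutionBound x₀ d T k C) ∧
      (∀ ε : ℝ, 0 < ε → ∃ τ : ℝ, 0 ≤ τ ∧
        ∀ x₀ : EuclideanSpace ℝ (Fin n), ‖x₀‖ ≤ M →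
          ∀ T ∈ samplingSeqs Tmax, ∀ d ∈ disturbanceSeqs p D,
            ∀ k : ℕ, τ ≤ ∑ i ∈ Finset.range k, T i → F.SolutionBound x₀ d T k ε)

/-- The Lyapunov characterization by a family of functions `V_M : ℝⁿ → [0, ∞]`. The difference in
the decrease condition is taken in the extended reals; its second term is finite there. -/
def HasSemiglobalLyapunovFamily (F : DTModel n p) (D : ℝ) : Prop :=
  ∃ α₁ α₂ α₃ : ℝ → ℝ, IsClassKInf α₁ ∧ IsClassKInf α₂ ∧ IsClassKInf α₃ ∧
    ∀ M : ℝ, 0 ≤ M → ∃ Tmax : ℝ, 0 < Tmax ∧ ∃ V : EuclideanSpace ℝ (Fin n) → ℝ≥0∞,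
      (∀ x, ENNReal.ofReal (α₁ ‖x‖) ≤ V x) ∧
      (∀ x, ‖x‖ ≤ M → V x ≤ ENNReal.ofReal (α₂ ‖x‖)) ∧
      ∀ (x : EuclideanSpace ℝ (Fin n)) (d : EuclideanSpace ℝ (Fin p)) (T : ℝ),
        ‖x‖ ≤ M → ‖d‖ ≤ D → T ∈ Set.Ioo 0 Tmax →
          ∃ y ∈ F x d T, (V y : EReal) - (V x : EReal) ≤ ((-(T * α₃ ‖x‖) : ℝ) : EReal)

end DTModel

/-! The cycle is 3 → 2 → 1 → 3. For 3 → 2, `V_M` is nonincreasing along solutions and loses at least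
`T α₃(r)` per step while `|x| ≥ r`, so sublevel sets give stability and boundedness, and elapsed
time gives attractivity. For 2 → 1, `b(s,t)` is the supremum of the norms reached after time `t`
from the ball of radius `s`; it is monotone in each variable, and averaging over `[s, 2s]` turns it
into a `KL` bound. One `β` serves every `M` because the sampling bound used in `b` depends on the
initial state. For 1 → 3, Sontag's lemma (`IsClassKL.exists_exp_decay`) gives `α₁(β(s,t)) eᵗ ≤
α₂(s)`, with `α₁`, `α₂` independent of `M`. Then `V`, the supremum of `α₁(|x_k|)` weighted by the
exponential of elapsed time, shrinks by the factor `e^{-T}` at each step; it may be infinite outside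
the ball of radius `M`. -/

/-! ### Comparison functions -/

/-- The average of `g` over `[s, 2s]`, written so that it makes sense at `s = 0`. -/
noncomputable def dyadicAverage (g : ℝ → ℝ) (s : ℝ) : ℝ := ∫ σ in (1 : ℝ)..2, g (s * σ)

theorem Monotone.comp_const_mul_intervalIntegrable {g : ℝ → ℝ} (hg : Monotone g) {s : ℝ}
    (hs : 0 ≤ s) (a b : ℝ) :
    IntervalIntegrable (fun σ => g (s * σ)) MeasureTheory.volume a b :=
  (hg.comp (monotone_mul_left_of_nonneg hs)).intervalIntegrable

theorem dyadicAverage_le_dyadicAverage {f g : ℝ → ℝ} (hf : Monotone f) (hg : Monotone g)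
    {s t : ℝ} (hs : 0 ≤ s) (ht : 0 ≤ t) (h : ∀ σ ∈ Set.Icc (1 : ℝ) 2, f (s * σ) ≤ g (t * σ)) :
    dyadicAverage f s ≤ dyadicAverage g t :=
  intervalIntegral.integral_mono_on (by norm_num) (hf.comp_const_mul_intervalIntegrable hs _ _)
    (hg.comp_const_mul_intervalIntegrable ht _ _) h

theorem le_dyadicAverage {g : ℝ → ℝ} (hg : Monotone g) {s : ℝ} (hs : 0 ≤ s) :
    g s ≤ dyadicAverage g s := by
  have h := intervalIntegral.integral_mono_on (a := 1) (b := 2) (f := fun _ => g s)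
    (μ := MeasureTheory.volume)
    (by norm_num) (by simp) (hg.comp_const_mul_intervalIntegrable hs _ _)
    (fun σ hσ => hg (le_mul_of_one_le_right hs hσ.1))
  norm_num at h
  exact h

theorem dyadicAverage_le {g : ℝ → ℝ} (hg : Monotone g) {s : ℝ} (hs : 0 ≤ s) :
    dyadicAverage g s ≤ g (s * 2) := by
  have h := intervalIntegral.integral_mono_on (a := 1) (b := 2) (g := fun _ => g (s * 2))
    (μ := MeasureTheory.volume)
    (by norm_num) (hg.comp_const_mul_intervalIntegrable hs _ _) (by simp)
    (fun σ hσ => hg (mul_le_mul_of_nonneg_left hσ.2 hs))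
  norm_num at h
  exact h

theorem dyadicAverage_zero {g : ℝ → ℝ} (hg : Monotone g) (h0 : ∀ s, 0 ≤ g s)
    (hsmall : ∀ ε > 0, ∃ δ > 0, g δ ≤ ε) : dyadicAverage g 0 = 0 := by
  refine le_antisymm (le_of_forall_pos_le_add fun ε hε => ?_)
    ((h0 0).trans (le_dyadicAverage hg le_rfl))
  obtain ⟨δ, hδ, h⟩ := hsmall ε hε
  have h₁ := dyadicAverage_le hg le_rfl
  have h₂ : g (0 * 2) ≤ g δ := hg (by linarith)
  linarith

/-- Away from `0` a change of variables gives `s⁻¹` times a difference of primitives of `g`,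
continuous even if `g` jumps. At `0` the average is squeezed by `g (2s)`. -/
theorem continuousOn_dyadicAverage {g : ℝ → ℝ} (hg : Monotone g) (h0 : ∀ s, 0 ≤ g s)
    (hsmall : ∀ ε > 0, ∃ δ > 0, g δ ≤ ε) : ContinuousOn (dyadicAverage g) (Set.Ici 0) := by
  intro s hs
  rcases (Set.mem_Ici.1 hs).eq_or_lt with rfl | hs
  · have hav := dyadicAverage_zero hg h0 hsmall
    rw [Metric.continuousWithinAt_iff]
    intro ε hε
    obtain ⟨δ, hδ, h⟩ := hsmall (ε / 2) (by positivity)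
    refine ⟨δ / 2, by positivity, fun x hx hxd => ?_⟩
    have hx : 0 ≤ x := hx
    rw [Real.dist_eq, sub_zero, abs_of_nonneg hx] at hxd
    rw [hav, Real.dist_eq, sub_zero,
      abs_of_nonneg ((h0 x).trans (le_dyadicAverage hg hx))]
    have h₁ := dyadicAverage_le hg hx
    have h₂ : g (x * 2) ≤ g δ := hg (by linarith)
    linarith
  · have hint : ∀ a b, IntervalIntegrable g MeasureTheory.volume a b :=
      fun a b => hg.intervalIntegrable
    have hcont := intervalIntegral.continuous_primitive hint 0
    have heq : dyadicAverage g =ᶠ[𝓝 s]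
        fun x => x⁻¹ * ((∫ y in (0 : ℝ)..x * 2, g y) - ∫ y in (0 : ℝ)..x, g y) := by
      filter_upwards [lt_mem_nhds hs] with x hx
      rw [intervalIntegral.integral_interval_sub_left (hint _ _) (hint _ _), dyadicAverage,
        intervalIntegral.integral_comp_mul_left _ hx.ne', mul_one, smul_eq_mul]
    refine ContinuousAt.continuousWithinAt (ContinuousAt.congr_of_eventuallyEq ?_ heq)
    exact (continuousAt_inv₀ hs.ne').mul
      ((hcont.comp (continuous_id.mul continuous_const)).sub hcont).continuousAt

/-- The average is only nondecreasing; the linear term makes the sum strictly increasing. -/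
theorem isClassK_mul_add_dyadicAverage {g : ℝ → ℝ} (hg : Monotone g) (h0 : ∀ s, 0 ≤ g s)
    (hsmall : ∀ ε > 0, ∃ δ > 0, g δ ≤ ε) {c : ℝ} (hc : 0 < c) :
    IsClassK fun s => s * c + dyadicAverage g s where
  continuousOn := (continuous_id.mul continuous_const).continuousOn.add
    (continuousOn_dyadicAverage hg h0 hsmall)
  strictMonoOn := fun _ hs _ ht hst => add_lt_add_of_lt_of_le (mul_lt_mul_of_pos_right hst hc)
    (dyadicAverage_le_dyadicAverage hg hg hs ht fun _ hσ =>
      hg (mul_le_mul_of_nonneg_right hst.le (zero_le_one.trans hσ.1)))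
  map_zero := by simp [dyadicAverage_zero hg h0 hsmall]

theorem exists_isClassKInf_ge {g : ℝ → ℝ} (hg : MonotoneOn g (Set.Ici 0)) (h0 : 0 ≤ g 0)
    (hsmall : ∀ ε > 0, ∃ δ > 0, g δ ≤ ε) : ∃ α, IsClassKInf α ∧ ∀ s, 0 ≤ s → g s ≤ α s := by
  have hmono : Monotone fun s => g (max 0 s) := fun s t hst =>
    hg (le_max_left 0 s) (le_max_left 0 t) (max_le_max_left 0 hst)
  have hnonneg : ∀ s, 0 ≤ g (max 0 s) := fun s =>
    h0.trans (hg Set.self_mem_Ici (le_max_left 0 s) (le_max_left 0 s))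
  have hge : ∀ s, 0 ≤ s → g s ≤ dyadicAverage (fun s => g (max 0 s)) s := fun s hs => by
    simpa [max_eq_right hs] using le_dyadicAverage hmono hs
  refine ⟨_, ⟨isClassK_mul_add_dyadicAverage hmono hnonneg (fun ε hε => ?_) one_pos,
    fun C => ⟨|C| + 1, by positivity, ?_⟩⟩, fun s hs => ?_⟩
  · obtain ⟨δ, hδ, h⟩ := hsmall ε hε
    exact ⟨δ, hδ, by simpa [max_eq_right hδ.le] using h⟩
  · have h₁ := (hnonneg (|C| + 1)).trans (le_dyadicAverage hmono (by positivity))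
    have h₂ := le_abs_self C
    simp only [mul_one]
    linarith
  · have := hge s hs
    simp only [mul_one]
    linarith

/-- The term `s e^{-t}` supplies strictness in both variables, and the bound `b (2s) t` on the
average supplies the limit in `t`. -/
theorem exists_isClassKL_ge {b : ℝ → ℝ → ℝ} (hmono : ∀ t, Monotone fun s => b s t)
    (hanti : ∀ s, Antitone (b s)) (h0 : ∀ s t, 0 ≤ b s t)
    (hlim : ∀ s, Tendsto (b s) atTop (𝓝 0)) (hsmall : ∀ ε > 0, ∃ δ > 0, b δ 0 ≤ ε) :
    ∃ β, IsClassKL β ∧ ∀ s t, 0 ≤ s → b s t ≤ β s t := by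
  refine ⟨fun s t => s * Real.exp (-t) + dyadicAverage (fun s => b s t) s, ⟨fun t ht => ?_,
    fun s hs t _ u _ htu => ?_, fun s hs => ?_⟩, fun s t hs => ?_⟩
  · refine isClassK_mul_add_dyadicAverage (hmono t) (fun s => h0 s t) (fun ε hε => ?_)
      (Real.exp_pos _)
    obtain ⟨δ, hδ, h⟩ := hsmall ε hε
    exact ⟨δ, hδ, (hanti δ ht).trans h⟩
  · exact add_lt_add_of_lt_of_le
      (mul_lt_mul_of_pos_left (Real.exp_lt_exp.2 (neg_lt_neg htu)) hs)
      (dyadicAverage_le_dyadicAverage (hmono u) (hmono t) hs.le hs.le fun σ _ =>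
        hanti (s * σ) htu.le)
  · have h₁ : Tendsto (fun t => s * Real.exp (-t)) atTop (𝓝 0) := by
      simpa using Real.tendsto_exp_neg_atTop_nhds_zero.const_mul s
    have h₂ : Tendsto (fun t => dyadicAverage (fun s => b s t) s) atTop (𝓝 0) :=
      squeeze_zero (fun t => (h0 s t).trans (le_dyadicAverage (hmono t) hs))
        (fun t => dyadicAverage_le (hmono t) hs) (hlim (s * 2))
    simpa using h₁.add h₂
  · have h₁ := le_dyadicAverage (hmono t) hs
    have h₂ : 0 ≤ s * Real.exp (-t) := by positivity
    simp only at h₁ ⊢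
    linarith

theorem isClassKInf_primitive {ψ : ℝ → ℝ} (hψ : Monotone ψ) (hpos : ∀ r, 0 < r → 0 < ψ r) :
    IsClassKInf fun r => ∫ y in (0 : ℝ)..r, ψ y := by
  have hint : ∀ a b, IntervalIntegrable ψ MeasureTheory.volume a b :=
    fun a b => hψ.intervalIntegrable
  have hstrict : StrictMonoOn (fun r => ∫ y in (0 : ℝ)..r, ψ y) (Set.Ici 0) := by
    intro a ha b _ hab
    have h := intervalIntegral.intervalIntegral_pos_of_pos_on (hint a b)
      (fun x hx => hpos x (lt_of_le_of_lt ha hx.1)) hab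
    rw [← intervalIntegral.integral_interval_sub_left (hint 0 b) (hint 0 a)] at h
    exact sub_pos.1 h
  -- The witness makes the integral of the constant `ψ 1` over `[1, r]` equal to `|C| + 1`, and `ψ ≥
  -- ψ 1` there.
  refine ⟨⟨(intervalIntegral.continuous_primitive hint 0).continuousOn, hstrict, by simp⟩,
    fun C => ⟨1 + (|C| + 1) / ψ 1, ?_, ?_⟩⟩
  · have := hpos 1 one_pos
    positivity
  · have h1 := hpos 1 one_pos
    set r := 1 + (|C| + 1) / ψ 1 with hr
    have hr1 : 1 ≤ r := by
      have : 0 ≤ (|C| + 1) / ψ 1 := by positivity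
      linarith
    have h₁ := intervalIntegral.integral_mono_on hr1 (f := fun _ => ψ 1) (by simp)
      (hint 1 r) (fun x hx => hψ hx.1)
    have h₂ : (∫ _ in (1 : ℝ)..r, ψ 1) = |C| + 1 := by
      rw [intervalIntegral.integral_const, smul_eq_mul, hr]
      field_simp
      ring
    have h₃ := hstrict Set.self_mem_Ici (Set.mem_Ici.2 zero_le_one) one_pos
    have h₄ := intervalIntegral.integral_add_adjacent_intervals (hint 0 1) (hint 1 r)
    simp only [intervalIntegral.integral_same] at h₃
    have h₅ := le_abs_self C
    linarith

theorem primitive_le_mul {ψ : ℝ → ℝ} (hψ : Monotone ψ) {r : ℝ} (hr : 0 ≤ r) :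
    ∫ y in (0 : ℝ)..r, ψ y ≤ r * ψ r := by
  have h := intervalIntegral.integral_mono_on hr (g := fun _ => ψ r)
    (hψ.intervalIntegrable (μ := MeasureTheory.volume)) (by simp) (fun x hx => hψ hx.2)
  simpa using h

theorem IsClassK.nonneg {α : ℝ → ℝ} (h : IsClassK α) {s : ℝ} (hs : 0 ≤ s) : 0 ≤ α s := by
  simpa [h.map_zero] using h.strictMonoOn.monotoneOn Set.self_mem_Ici hs hs

theorem IsClassK.pos {α : ℝ → ℝ} (h : IsClassK α) {s : ℝ} (hs : 0 < s) : 0 < α s := by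
  simpa [h.map_zero] using h.strictMonoOn Set.self_mem_Ici (Set.mem_Ici.2 hs.le) hs

theorem IsClassK.mono {α : ℝ → ℝ} (h : IsClassK α) {s t : ℝ} (hs : 0 ≤ s) (hst : s ≤ t) :
    α s ≤ α t :=
  h.strictMonoOn.monotoneOn hs (hs.trans hst) hst

theorem IsClassK.le_of_map_le {α : ℝ → ℝ} (h : IsClassK α) {s t : ℝ} (hs : 0 ≤ s) (ht : 0 ≤ t)
    (hst : α s ≤ α t) : s ≤ t :=
  (h.strictMonoOn.le_iff_le hs ht).1 hst

theorem IsClassK.exists_pos_le {α : ℝ → ℝ} (h : IsClassK α) {ε : ℝ} (hε : 0 < ε) :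
    ∃ δ > 0, δ ≤ 1 ∧ α δ ≤ ε := by
  obtain ⟨δ, hδ, hd⟩ := Metric.continuousWithinAt_iff.1
    (h.continuousOn 0 Set.self_mem_Ici) ε hε
  have hpos : 0 < min (δ / 2) 1 := by positivity
  refine ⟨min (δ / 2) 1, hpos, min_le_right _ _, ?_⟩
  have hx := hd (Set.mem_Ici.2 hpos.le) (by
    rw [Real.dist_eq, sub_zero, abs_of_pos hpos]
    linarith [min_le_left (δ / 2) 1])
  rw [h.map_zero, Real.dist_eq, sub_zero] at hx
  exact (le_abs_self _).trans hx.le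

/-- The last time at which `β s` is at least `r`. -/
noncomputable def lastTimeGe (β : ℝ → ℝ → ℝ) (s r : ℝ) : ℝ := sSup {t | 0 ≤ t ∧ r ≤ β s t}

theorem lastTimeGe_nonneg (β : ℝ → ℝ → ℝ) (s r : ℝ) : 0 ≤ lastTimeGe β s r :=
  Real.sSup_nonneg fun _ ht => ht.1

theorem IsClassKL.bddAbove {β : ℝ → ℝ → ℝ} (hβ : IsClassKL β) {s r : ℝ} (hs : 0 ≤ s)
    (hr : 0 < r) : BddAbove {t | 0 ≤ t ∧ r ≤ β s t} := by
  obtain ⟨N, hN⟩ := eventually_atTop.1 ((hβ.tendsto_zero s hs).eventually_lt_const hr)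
  exact ⟨N, fun t ht => le_of_not_ge fun h => absurd (hN t h) (not_lt.2 ht.2)⟩

theorem IsClassKL.le_lastTimeGe {β : ℝ → ℝ → ℝ} (hβ : IsClassKL β) {s r t : ℝ} (hs : 0 ≤ s)
    (hr : 0 < r) (ht : 0 ≤ t) (h : r ≤ β s t) : t ≤ lastTimeGe β s r :=
  le_csSup (hβ.bddAbove hs hr) ⟨ht, h⟩

theorem IsClassKL.lastTimeGe_mono {β : ℝ → ℝ → ℝ} (hβ : IsClassKL β) {s s' r r' : ℝ}
    (hs : 0 ≤ s) (hss : s ≤ s') (hr : 0 < r') (hrr : r' ≤ r) :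
    lastTimeGe β s r ≤ lastTimeGe β s' r' :=
  Real.sSup_le (fun _ ht => hβ.le_lastTimeGe (hs.trans hss) hr ht.1
    (hrr.trans (ht.2.trans ((hβ.isClassK _ ht.1).mono hs hss)))) (lastTimeGe_nonneg _ _ _)

/-- Sontag's lemma on `KL` functions. -/
theorem IsClassKL.exists_exp_decay {β : ℝ → ℝ → ℝ} (hβ : IsClassKL β) :
    ∃ α₁ α₂, IsClassKInf α₁ ∧ IsClassKInf α₂ ∧
      ∀ s t, 0 ≤ s → 0 ≤ t → α₁ (β s t) * Real.exp t ≤ α₂ s := by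
  -- With `r = β s t`, `α₁(r) = ∫₀ʳ ψ ≤ r ψ(r)`. It remains to absorb `eᵗ` into `ψ(r)` or into a
  -- factor depending on `s` alone, according to whether `s ≤ 1/r` or not.
  set ψ : ℝ → ℝ := fun r => if 0 < r then Real.exp (-lastTimeGe β r⁻¹ r) else 0 with hψ_def
  have hψ_of_pos : ∀ r, 0 < r → ψ r = Real.exp (-lastTimeGe β r⁻¹ r) := fun r hr => if_pos hr
  have hψ : Monotone ψ := by
    intro r r' h
    by_cases hr : 0 < r
    · have hr' := hr.trans_le h
      rw [hψ_of_pos r hr, hψ_of_pos r' hr']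
      exact Real.exp_le_exp.2 (neg_le_neg (hβ.lastTimeGe_mono (inv_nonneg.2 hr'.le)
        (inv_anti₀ hr h) hr h))
    · simp only [hψ_def, if_neg hr]
      split_ifs <;> positivity
  have hβ0 := hβ.isClassK 0 le_rfl
  have hle0 : ∀ s t, 0 ≤ s → 0 ≤ t → β s t ≤ β s 0 := by
    intro s t hs ht
    rcases hs.eq_or_lt with rfl | hs
    · exact ((hβ.isClassK t ht).map_zero.trans hβ0.map_zero.symm).le
    · exact (hβ.strictAntiOn s hs).antitoneOn Set.self_mem_Ici ht ht
  have hα₁ := isClassKInf_primitive hψ fun r hr => by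
    rw [hψ_of_pos r hr]
    positivity
  obtain ⟨α₂, hα₂, hg⟩ := exists_isClassKInf_ge
    (g := fun s => β s 0 * Real.exp (lastTimeGe β s s⁻¹)) (by
      intro s hs s' hs' h
      rcases (Set.mem_Ici.1 hs).eq_or_lt with rfl | hpos
      · simp only [hβ0.map_zero, zero_mul]
        exact mul_nonneg (hβ0.nonneg hs') (Real.exp_pos _).le
      · exact mul_le_mul (hβ0.mono hs h) (Real.exp_le_exp.2 (hβ.lastTimeGe_mono hs h
          (inv_pos.2 (hpos.trans_le h)) (inv_anti₀ hpos h))) (Real.exp_pos _).le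
          (hβ0.nonneg hs')) (by simp [hβ0.map_zero]) (by
      intro ε hε
      -- For `δ ≤ 1` the last time for `(δ, 1/δ)` is at most that for `(1, 1)`, so the exponential
      -- factor stays bounded near `0`.
      obtain ⟨δ, hδ, hδ1, h⟩ := hβ0.exists_pos_le (div_pos hε (Real.exp_pos (lastTimeGe β 1 1)))
      refine ⟨δ, hδ, ?_⟩
      rw [le_div_iff₀ (Real.exp_pos _)] at h
      refine (mul_le_mul_of_nonneg_left (Real.exp_le_exp.2 ?_) (hβ0.nonneg hδ.le)).trans h
      exact hβ.lastTimeGe_mono hδ.le hδ1 one_pos ((one_le_inv₀ hδ).2 hδ1))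
  refine ⟨_, α₂, hα₁, hα₂, fun s t hs ht => le_trans ?_ (hg s hs)⟩
  have hr : 0 ≤ β s t := (hβ.isClassK t ht).nonneg hs
  rcases hr.eq_or_lt with hr | hr
  · simp only [← hr, intervalIntegral.integral_same, zero_mul]
    exact mul_nonneg (hβ0.nonneg hs) (Real.exp_pos _).le
  have hspos : 0 < s := by
    rcases hs.eq_or_lt with rfl | h
    · exact absurd (hβ.isClassK t ht).map_zero hr.ne'
    · exact h
  have hbound := primitive_le_mul hψ hr.le
  rw [hψ_of_pos _ hr] at hbound
  refine (mul_le_mul_of_nonneg_right hbound (Real.exp_pos t).le).trans ?_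
  rw [mul_assoc, ← Real.exp_add]
  refine mul_le_mul (hle0 s t hs ht) (Real.exp_le_exp.2 ?_) (Real.exp_pos _).le (hβ0.nonneg hs)
  have hlast := lastTimeGe_nonneg β (β s t)⁻¹ (β s t)
  have hlast' := lastTimeGe_nonneg β s s⁻¹
  -- If `r ≤ 1/s`, then `t` is at most the last time for `(s, r)`, hence for `(1/r, r)`, which
  -- `ψ(r)` cancels. Otherwise `t` is at most the last time for `(s, 1/s)`.
  rcases le_total (β s t) s⁻¹ with h | h
  · have h₁ := hβ.le_lastTimeGe hs hr ht le_rfl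
    have h₂ := hβ.lastTimeGe_mono hs ((le_inv_comm₀ hr hspos).1 h) hr le_rfl
    linarith
  · have h₁ := hβ.le_lastTimeGe hs (inv_pos.2 hspos) ht h
    linarith

namespace DTModel

variable {n p : ℕ}

/-! ### Solutions -/

/-- The solution from `F(x, d, T)` is a shifted solution from `x`. -/
theorem mem_solution_cons {F : DTModel n p} {x y z : EuclideanSpace ℝ (Fin n)}
    {d₀ : EuclideanSpace ℝ (Fin p)} {T₀ : ℝ} (hy : y ∈ F x d₀ T₀)
    {d : ℕ → EuclideanSpace ℝ (Fin p)} {T : ℕ → ℝ} {k : ℕ} (hz : z ∈ F.solution y d T k) :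
    z ∈ F.solution x (fun i => i.casesOn d₀ d) (fun i => i.casesOn T₀ T) (k + 1) := by
  induction k generalizing z with
  | zero =>
    rw [solution, Part.mem_some_iff] at hz
    subst hz
    exact Part.mem_bind (Part.mem_some x) hy
  | succ k ih =>
    obtain ⟨w, hw, hz⟩ := Part.mem_bind_iff.1 hz
    exact Part.mem_bind (ih hw) hz

theorem sum_range_nonneg_of_mem_samplingSeqs {Tmax : ℝ} {T : ℕ → ℝ} (hT : T ∈ samplingSeqs Tmax)
    (k : ℕ) : 0 ≤ ∑ i ∈ Finset.range k, T i :=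
  Finset.sum_nonneg fun i _ => (hT i).1.le

/-! ### From a Lyapunov family to the `ε`-`δ` characterization -/

/-- Since `⊤` minus a finite value is `⊤`, the decrease condition itself propagates finiteness of
`V` along solutions. -/
theorem toReal_le_of_sub_le {a b : ℝ≥0∞} {c : ℝ} (hb : b ≠ ∞)
    (h : (a : EReal) - (b : EReal) ≤ (c : EReal)) : a ≠ ∞ ∧ a.toReal ≤ b.toReal + c := by
  lift b to NNReal using hb
  induction a with
  | top =>
    exfalso
    simp at h
  | coe a =>
    refine ⟨ENNReal.coe_ne_top, ?_⟩
    have h' : (((a : ℝ) - (b : ℝ) : ℝ) : EReal) ≤ (c : EReal) := h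
    rw [EReal.coe_le_coe_iff] at h'
    simp only [ENNReal.coe_toReal]
    linarith

theorem HasSemiglobalLyapunovFamily.isSemiglobalEpsDelta {F : DTModel n p} {D : ℝ}
    (h : F.HasSemiglobalLyapunovFamily D) : F.IsSemiglobalEpsDelta D := by
  obtain ⟨α₁, α₂, α₃, hα₁, hα₂, hα₃, hV⟩ := h
  have hδ : ∀ ε : ℝ, ∃ δ, 0 < ε → 0 < δ ∧ α₂ δ ≤ α₁ ε := fun ε => by
    by_cases hε : 0 < ε
    · obtain ⟨δ, h₁, -, h₂⟩ := hα₂.exists_pos_le (hα₁.pos hε)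
      exact ⟨δ, fun _ => ⟨h₁, h₂⟩⟩
    · exact ⟨0, fun h => absurd h hε⟩
  choose δ hδ using hδ
  refine ⟨δ, fun ε hε => (hδ ε hε).1, fun M hM => ?_⟩
  -- The sublevel set `V ≤ α₂ M` lies in the ball of radius `M'`, so taking `V` for `max M M'` keeps
  -- its bounds valid along the whole solution.
  obtain ⟨M', hM', hMM'⟩ := hα₁.unbounded (α₂ M)
  obtain ⟨Tmax, hTmax, V, hV₁, hV₂, hV₃⟩ := hV (max M M') (le_max_of_le_left hM)
  -- along a solution from `‖x₀‖ ≤ M`, `V` is finite, at most `α₂ M`, and decreases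
  have hlower : ∀ x, V x ≠ ∞ → α₁ ‖x‖ ≤ (V x).toReal := fun x hx =>
    (ENNReal.ofReal_le_iff_le_toReal hx).1 (hV₁ x)
  have hupper : ∀ x, ‖x‖ ≤ max M M' → V x ≠ ∞ ∧ (V x).toReal ≤ α₂ ‖x‖ := fun x hx =>
    ⟨((hV₂ x hx).trans_lt ENNReal.ofReal_lt_top).ne,
      ENNReal.toReal_le_of_le_ofReal (hα₂.nonneg (norm_nonneg x)) (hV₂ x hx)⟩
  have hnorm : ∀ x, V x ≠ ∞ → (V x).toReal ≤ α₂ M → ‖x‖ ≤ M' := fun x hx hle =>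
    hα₁.le_of_map_le (norm_nonneg x) hM' ((hlower x hx).trans (hle.trans hMM'.le))
  -- In the final alternative, either some earlier state had norm at most `r`, and `V ≤ α₂ r`
  -- persists, or every step so far lost at least `T α₃ r`.
  have key : ∀ x₀ : EuclideanSpace ℝ (Fin n), ‖x₀‖ ≤ M → ∀ T ∈ samplingSeqs Tmax,
      ∀ d ∈ disturbanceSeqs p D, ∀ k, ∃ x ∈ F.solution x₀ d T k,
        V x ≠ ∞ ∧ (V x).toReal ≤ (V x₀).toReal ∧ ‖x‖ ≤ M' ∧
        ∀ r > 0, (V x).toReal ≤ α₂ r ∨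
          (V x).toReal ≤ α₂ M - (∑ i ∈ Finset.range k, T i) * α₃ r := by
    intro x₀ hx₀ T hT d hd k
    obtain ⟨h₁, h₂⟩ := hupper x₀ (le_max_of_le_left hx₀)
    have h₃ : (V x₀).toReal ≤ α₂ M := h₂.trans (hα₂.mono (norm_nonneg _) hx₀)
    induction k with
    | zero =>
      exact ⟨x₀, Part.mem_some _, h₁, le_rfl, hnorm x₀ h₁ h₃, fun r _ => Or.inr (by simpa)⟩
    | succ k ih =>
      obtain ⟨x, hx, hfin, hle, hxM, hdec⟩ := ih
      obtain ⟨y, hy, hxy⟩ := hV₃ x (d k) (T k) (le_max_of_le_right hxM) (hd k) (hT k)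
      obtain ⟨hyfin, hyle⟩ := toReal_le_of_sub_le hfin hxy
      have hstep : 0 ≤ T k * α₃ ‖x‖ := mul_nonneg (hT k).1.le (hα₃.nonneg (norm_nonneg x))
      refine ⟨y, Part.mem_bind hx hy, hyfin, by linarith, hnorm y hyfin (by linarith),
        fun r hr => ?_⟩
      rcases hdec r hr with h | h
      · exact Or.inl (by linarith)
      rcases le_total ‖x‖ r with hxr | hxr
      · have h₄ := (hupper x (le_max_of_le_right hxM)).2
        have h₅ := hα₂.mono (norm_nonneg x) hxr
        exact Or.inl (by linarith)
      · have h₄ := mul_le_mul_of_nonneg_left (hα₃.mono hr.le hxr) (hT k).1.le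
        rw [Finset.sum_range_succ, add_mul]
        exact Or.inr (by linarith)
  -- Past time `α₂ M / α₃ (δ ε)`, the second alternative of `key` would give `V ≤ 0`.
  refine ⟨Tmax, hTmax, fun ε hε x₀ hx₀ T hT d hd k => ?_, fun L _ => ⟨M', hM',
    fun x₀ hx₀ T hT d hd k _ => ?_⟩, fun ε hε => ⟨α₂ M / α₃ (δ ε), ?_,
    fun x₀ hx₀ T hT d hd k hk => ?_⟩⟩
  · have hx₀M := hx₀.trans (min_le_right _ _)
    obtain ⟨x, hx, hfin, hle, -⟩ := key x₀ hx₀M T hT d hd k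
    refine ⟨x, hx, hα₁.le_of_map_le (norm_nonneg x) hε.le ?_⟩
    have h₁ := hlower x hfin
    have h₂ := (hupper x₀ (le_max_of_le_left hx₀M)).2
    have h₃ := hα₂.mono (norm_nonneg x₀) (hx₀.trans (min_le_left _ _))
    have h₄ := (hδ ε hε).2
    linarith
  · obtain ⟨x, hx, -, -, hxM, -⟩ := key x₀ hx₀ T hT d hd k
    exact ⟨x, hx, hxM⟩
  · exact div_nonneg (hα₂.nonneg hM) (hα₃.nonneg (hδ ε hε).1.le)
  · obtain ⟨x, hx, hfin, -, -, hdec⟩ := key x₀ hx₀ T hT d hd k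
    refine ⟨x, hx, hα₁.le_of_map_le (norm_nonneg x) hε.le ((hlower x hfin).trans ?_)⟩
    rcases hdec (δ ε) (hδ ε hε).1 with h | h
    · exact h.trans (hδ ε hε).2
    · have h₁ := (div_le_iff₀ (hα₃.pos (hδ ε hε).1)).1 hk
      have h₂ := (hα₁.pos hε).le
      linarith

/-! ### From the `ε`-`δ` characterization to a `KL` bound -/

/-- The norms reached at elapsed time at least `t` by solutions whose initial state has norm at
most `s`, the sampling periods being bounded in terms of the initial state. -/
def reachedNorms (F : DTModel n p) (D : ℝ) (Tmax : ℕ → ℝ) (s t : ℝ) : Set ℝ :=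
  {r | ∃ x₀ : EuclideanSpace ℝ (Fin n), ‖x₀‖ ≤ s ∧ ∃ T ∈ samplingSeqs (Tmax ⌈‖x₀‖⌉₊),
    ∃ d ∈ disturbanceSeqs p D, ∃ k, t ≤ ∑ i ∈ Finset.range k, T i ∧
      ∃ x ∈ F.solution x₀ d T k, r = ‖x‖}

theorem SolutionBound.norm_le {F : DTModel n p} {x₀ : EuclideanSpace ℝ (Fin n)}
    {d : ℕ → EuclideanSpace ℝ (Fin p)} {T : ℕ → ℝ} {k : ℕ} {b : ℝ}
    (h : F.SolutionBound x₀ d T k b) {x : EuclideanSpace ℝ (Fin n)}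
    (hx : x ∈ F.solution x₀ d T k) : ‖x‖ ≤ b := by
  obtain ⟨y, hy, hyb⟩ := h
  rwa [Part.mem_unique hx hy]

theorem samplingSeqs_mono {T T' : ℝ} (h : T ≤ T') : samplingSeqs T ⊆ samplingSeqs T' :=
  fun _ hτ i => ⟨(hτ i).1, (hτ i).2.trans_le h⟩

theorem IsSemiglobalEpsDelta.isRSSVSR {F : DTModel n p} {D : ℝ}
    (h : F.IsSemiglobalEpsDelta D) : F.IsRSSVSR D := by
  obtain ⟨δ, hδ, h⟩ := h
  -- sampling bounds decreasing in the integer `N`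
  have hnat : ∃ Tmax : ℕ → ℝ, Antitone Tmax ∧ ∀ N : ℕ, 0 < Tmax N ∧
      (∀ ε : ℝ, 0 < ε → ∀ x₀ : EuclideanSpace ℝ (Fin n), ‖x₀‖ ≤ min (δ ε) N →
          ∀ T ∈ samplingSeqs (Tmax N), ∀ d ∈ disturbanceSeqs p D,
            ∀ k : ℕ, F.SolutionBound x₀ d T k ε) ∧
      (∀ L : ℝ, 0 ≤ L → ∃ C : ℝ, 0 ≤ C ∧
        ∀ x₀ : EuclideanSpace ℝ (Fin n), ‖x₀‖ ≤ N →
          ∀ T ∈ samplingSeqs (Tmax N), ∀ d ∈ disturbanceSeqs p D,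
            ∀ k : ℕ, ∑ i ∈ Finset.range k, T i ≤ L → F.SolutionBound x₀ d T k C) ∧
      (∀ ε : ℝ, 0 < ε → ∃ τ : ℝ, 0 ≤ τ ∧
        ∀ x₀ : EuclideanSpace ℝ (Fin n), ‖x₀‖ ≤ N →
          ∀ T ∈ samplingSeqs (Tmax N), ∀ d ∈ disturbanceSeqs p D,
            ∀ k : ℕ, τ ≤ ∑ i ∈ Finset.range k, T i → F.SolutionBound x₀ d T k ε) := by
    choose T₀ hT₀ h₁ h₂ h₃ using fun N : ℕ => h N N.cast_nonneg
    let Tmax : ℕ → ℝ := fun N => (Finset.range (N + 1)).inf' Finset.nonempty_range_add_one T₀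
    have hle : ∀ N, Tmax N ≤ T₀ N := fun N => Finset.inf'_le _ (Finset.self_mem_range_succ N)
    refine ⟨Tmax, fun N N' hN => Finset.inf'_mono _
      (Finset.range_mono (Nat.succ_le_succ hN)) _, fun N => ⟨?_, ?_, ?_, ?_⟩⟩
    · exact (Finset.lt_inf'_iff _).2 fun i _ => hT₀ i
    · exact fun ε hε x₀ hx₀ T hT => h₁ N ε hε x₀ hx₀ T (samplingSeqs_mono (hle N) hT)
    · intro L hL
      obtain ⟨C, hC, hb⟩ := h₂ N L hL
      exact ⟨C, hC, fun x₀ hx₀ T hT => hb x₀ hx₀ T (samplingSeqs_mono (hle N) hT)⟩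
    · intro ε hε
      obtain ⟨τ, hτ, hb⟩ := h₃ N ε hε
      exact ⟨τ, hτ, fun x₀ hx₀ T hT => hb x₀ hx₀ T (samplingSeqs_mono (hle N) hT)⟩
  clear h
  obtain ⟨Tmax, hanti, h⟩ := hnat
  -- uniform attractivity and boundedness over each bounded set of initial states
  have hattr : ∀ s : ℝ, ∀ ε > 0, ∃ τ, ∀ t ≥ τ, ∀ r ∈ F.reachedNorms D Tmax s t, r ≤ ε := by
    intro s ε hε
    choose τ hτ hb using fun N => (h N).2.2.2 ε hε
    -- The sum of nonnegative terms stands in for a maximum over the finitely many possible values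
    -- of `⌈‖x₀‖⌉₊`.
    refine ⟨∑ N ∈ Finset.range (⌈s⌉₊ + 1), τ N, fun t ht r hr => ?_⟩
    obtain ⟨x₀, hx₀, T, hT, d, hd, k, hk, x, hx, rfl⟩ := hr
    have hmem : ⌈‖x₀‖⌉₊ ∈ Finset.range (⌈s⌉₊ + 1) :=
      Finset.mem_range.2 (Nat.lt_succ_of_le (Nat.ceil_mono hx₀))
    have hτle := Finset.single_le_sum (fun N _ => hτ N) hmem
    exact (hb _ x₀ (Nat.le_ceil _) T hT d hd k (hτle.trans (ht.trans hk))).norm_le hx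
  have hbdd : ∀ s t : ℝ, BddAbove (F.reachedNorms D Tmax s t) := by
    intro s t
    -- After time `τ N` attractivity bounds the norm by `1`; before it, boundedness with `L = τ N`
    -- applies.
    choose τ hτ hb using fun N => (h N).2.2.2 1 one_pos
    choose C hC hc using fun N => (h N).2.2.1 (τ N) (hτ N)
    refine ⟨1 + ∑ N ∈ Finset.range (⌈s⌉₊ + 1), C N, fun r hr => ?_⟩
    obtain ⟨x₀, hx₀, T, hT, d, hd, k, -, x, hx, rfl⟩ := hr
    have hmem : ⌈‖x₀‖⌉₊ ∈ Finset.range (⌈s⌉₊ + 1) :=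
      Finset.mem_range.2 (Nat.lt_succ_of_le (Nat.ceil_mono hx₀))
    have hCle := Finset.single_le_sum (fun N _ => hC N) hmem
    have hCnn := hC ⌈‖x₀‖⌉₊
    rcases le_total (τ ⌈‖x₀‖⌉₊) (∑ i ∈ Finset.range k, T i) with hk | hk
    · have := (hb _ x₀ (Nat.le_ceil _) T hT d hd k hk).norm_le hx
      linarith
    · have := (hc _ x₀ (Nat.le_ceil _) T hT d hd k hk).norm_le hx
      linarith
  have hnonneg : ∀ s t : ℝ, 0 ≤ sSup (F.reachedNorms D Tmax s t) := fun s t =>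
    Real.sSup_nonneg (by rintro _ ⟨x₀, -, T, -, d, -, k, -, x, -, rfl⟩; exact norm_nonneg x)
  have hmono : ∀ {s s' t t' : ℝ}, s ≤ s' → t' ≤ t →
      sSup (F.reachedNorms D Tmax s t) ≤ sSup (F.reachedNorms D Tmax s' t') := by
    intro s s' t t' hs ht
    refine Real.sSup_le (fun r hr => le_csSup (hbdd s' t') ?_) (hnonneg _ _)
    obtain ⟨x₀, hx₀, T, hT, d, hd, k, hk, hx⟩ := hr
    exact ⟨x₀, hx₀.trans hs, T, hT, d, hd, k, ht.trans hk, hx⟩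
  obtain ⟨β, hβ, hle⟩ := exists_isClassKL_ge (b := fun s t => sSup (F.reachedNorms D Tmax s t))
    (fun t s s' hs => hmono hs le_rfl) (fun s t t' ht => hmono le_rfl ht) hnonneg
    (fun s => by
      rw [Metric.tendsto_atTop]
      intro ε hε
      obtain ⟨τ, hτ⟩ := hattr s (ε / 2) (half_pos hε)
      refine ⟨τ, fun t ht => ?_⟩
      rw [Real.dist_eq, sub_zero, abs_of_nonneg (hnonneg s t)]
      exact (Real.sSup_le (hτ t ht) (half_pos hε).le).trans_lt (half_lt_self hε))
    (fun ε hε => by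
      -- It matters here that `δ` does not depend on `M`: the initial states are treated with
      -- different integers `⌈‖x₀‖⌉₊`.
      refine ⟨δ ε, hδ ε hε, Real.sSup_le (fun r hr => ?_) hε.le⟩
      obtain ⟨x₀, hx₀, T, hT, d, hd, k, hk, x, hx, rfl⟩ := hr
      exact ((h _).2.1 ε hε x₀ (le_min hx₀ (Nat.le_ceil _)) T hT d hd k).norm_le hx)
  refine ⟨β, hβ, fun M hM => ⟨Tmax ⌈M⌉₊, (h _).1, fun k T hT x₀ hx₀ d hd => ?_⟩⟩
  have hT' := samplingSeqs_mono (hanti (Nat.ceil_mono hx₀)) hT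
  -- Boundedness is used only for the existence of `x_k`; the value of `C` is discarded.
  obtain ⟨C, -, hC⟩ := (h ⌈‖x₀‖⌉₊).2.2.1 _ (sum_range_nonneg_of_mem_samplingSeqs hT k)
  obtain ⟨x, hx, -⟩ := hC x₀ (Nat.le_ceil _) T hT' d hd k le_rfl
  exact ⟨x, hx, (le_csSup (hbdd _ _) ⟨x₀, le_rfl, T, hT', d, hd, k, le_rfl, x, hx, rfl⟩).trans
    (hle _ _ (norm_nonneg x₀))⟩

/-! ### From a `KL` bound to a Lyapunov family -/

/-- The supremum of `α(|x_k|) exp(T_0 + ⋯ + T_{k-1})` over the solutions from `x`. -/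
noncomputable def expWeightedSup (F : DTModel n p) (D Tmax : ℝ) (α : ℝ → ℝ)
    (x : EuclideanSpace ℝ (Fin n)) : ℝ≥0∞ :=
  ⨆ (T ∈ samplingSeqs Tmax) (d ∈ disturbanceSeqs p D) (k : ℕ) (y ∈ F.solution x d T k),
    ENNReal.ofReal (α ‖y‖ * Real.exp (∑ i ∈ Finset.range k, T i))

theorem le_expWeightedSup {F : DTModel n p} {D Tmax : ℝ} (α : ℝ → ℝ)
    {x y : EuclideanSpace ℝ (Fin n)} {T : ℕ → ℝ} (hT : T ∈ samplingSeqs Tmax)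
    {d : ℕ → EuclideanSpace ℝ (Fin p)} (hd : d ∈ disturbanceSeqs p D) {k : ℕ}
    (hy : y ∈ F.solution x d T k) :
    ENNReal.ofReal (α ‖y‖ * Real.exp (∑ i ∈ Finset.range k, T i)) ≤
      F.expWeightedSup D Tmax α x :=
  le_iSup₂_of_le T hT (le_iSup₂_of_le d hd (le_iSup_of_le k (le_iSup₂_of_le y hy le_rfl)))

/-- Every solution from `y` is the tail of one from `x` with elapsed time larger by `T₀`, hence with
weight larger by `e^{T₀}`. -/
theorem expWeightedSup_step {F : DTModel n p} {D Tmax : ℝ} (α : ℝ → ℝ)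
    {x y : EuclideanSpace ℝ (Fin n)} {d₀ : EuclideanSpace ℝ (Fin p)} (hd₀ : ‖d₀‖ ≤ D) {T₀ : ℝ}
    (hT₀ : T₀ ∈ Set.Ioo 0 Tmax) (hy : y ∈ F x d₀ T₀) :
    F.expWeightedSup D Tmax α y ≤
      ENNReal.ofReal (Real.exp (-T₀)) * F.expWeightedSup D Tmax α x := by
  refine iSup₂_le fun T hT => iSup₂_le fun d hd => iSup_le fun k => iSup₂_le fun z hz => ?_
  have h := le_expWeightedSup (F := F) (D := D) (Tmax := Tmax) α
    (T := fun i => i.casesOn T₀ T) (d := fun i => i.casesOn d₀ d)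
    (by rintro (_ | i); exacts [hT₀, hT i]) (by rintro (_ | i); exacts [hd₀, hd i])
    (mem_solution_cons hy hz)
  refine le_trans (le_of_eq ?_) (mul_le_mul_right h _)
  rw [← ENNReal.ofReal_mul (Real.exp_pos _).le, Finset.sum_range_succ', mul_left_comm,
    ← Real.exp_add]
  congr 3
  simp

theorem IsRSSVSR.hasSemiglobalLyapunovFamily {F : DTModel n p} {D : ℝ} (hD : 0 ≤ D)
    (h : F.IsRSSVSR D) : F.HasSemiglobalLyapunovFamily D := by
  obtain ⟨β, hβ, h⟩ := h
  obtain ⟨α₁, α₂, hα₁, hα₂, hdecay⟩ := hβ.exists_exp_decay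
  -- The half comes from `e^{-T} ≤ 1 - T/2` for `0 ≤ T ≤ 1`, which is also why sampling periods are
  -- capped at `1`.
  have hα₃ : IsClassKInf fun s => α₁ s / 2 :=
    ⟨⟨hα₁.continuousOn.div_const 2,
      fun s hs t ht hst => div_lt_div_of_pos_right (hα₁.strictMonoOn hs ht hst) two_pos,
      by simp [hα₁.map_zero]⟩, fun C => by
        obtain ⟨s, hs, hC⟩ := hα₁.unbounded (C * 2)
        exact ⟨s, hs, (lt_div_iff₀ two_pos).2 hC⟩⟩
  refine ⟨α₁, α₂, _, hα₁, hα₂, hα₃, fun M hM => ?_⟩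
  obtain ⟨T₁, hT₁, h⟩ := h M hM
  have hTmax : 0 < min T₁ 1 := lt_min hT₁ one_pos
  have hsub := samplingSeqs_mono (min_le_left T₁ 1)
  have hlower : ∀ x, ENNReal.ofReal (α₁ ‖x‖) ≤ F.expWeightedSup D (min T₁ 1) α₁ x := by
    intro x
    -- The term `k = 0` suffices; any admissible pair of sequences will do, and the zero disturbance
    -- is admissible as `D ≥ 0`.
    have := le_expWeightedSup (F := F) (D := D) (Tmax := min T₁ 1) α₁
      (T := fun _ => min T₁ 1 / 2) (fun _ => ⟨half_pos hTmax, half_lt_self hTmax⟩)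
      (d := fun _ => 0) (fun _ => by simpa using hD) (k := 0) (Part.mem_some x)
    simpa using this
  have hupper : ∀ x, ‖x‖ ≤ M →
      F.expWeightedSup D (min T₁ 1) α₁ x ≤ ENNReal.ofReal (α₂ ‖x‖) := by
    intro x hx
    refine iSup₂_le fun T hT => iSup₂_le fun d hd => iSup_le fun k => iSup₂_le fun z hz =>
      ENNReal.ofReal_le_ofReal ?_
    refine le_trans (mul_le_mul_of_nonneg_right ?_ (Real.exp_pos _).le)
      (hdecay ‖x‖ _ (norm_nonneg x) (sum_range_nonneg_of_mem_samplingSeqs hT k))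
    exact hα₁.mono (norm_nonneg z) ((h k T (hsub hT) x hx d hd).norm_le hz)
  refine ⟨min T₁ 1, hTmax, F.expWeightedSup D (min T₁ 1) α₁, hlower, hupper,
    fun x d T hx hd hT => ?_⟩
  -- The `KL` bound at `k = 1` includes that `F x d T` is defined.
  obtain ⟨y, hy, -⟩ := h 1 (fun _ => T) (hsub fun _ => hT) x hx (fun _ => d) fun _ => hd
  replace hy : y ∈ F x d T := by simpa [solution] using hy
  refine ⟨y, hy, ?_⟩
  have hstep := expWeightedSup_step α₁ hd hT hy
  have hfin : F.expWeightedSup D (min T₁ 1) α₁ x ≠ ∞ :=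
    ((hupper x hx).trans_lt ENNReal.ofReal_lt_top).ne
  have hlow := (ENNReal.ofReal_le_iff_le_toReal hfin).1 (hlower x)
  generalize F.expWeightedSup D (min T₁ 1) α₁ x = a at hstep hfin hlow
  generalize F.expWeightedSup D (min T₁ 1) α₁ y = b at hstep
  have hbfin : b ≠ ∞ := (hstep.trans_lt (ENNReal.mul_lt_top ENNReal.ofReal_lt_top hfin.lt_top)).ne
  have hstep' := ENNReal.toReal_mono (ENNReal.mul_ne_top ENNReal.ofReal_ne_top hfin) hstep
  rw [ENNReal.toReal_mul, ENNReal.toReal_ofReal (Real.exp_pos _).le] at hstep'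
  lift a to NNReal using hfin
  lift b to NNReal using hbfin
  simp only [ENNReal.coe_toReal] at hstep' hlow
  suffices hreal : (b : ℝ) - a ≤ -(T * (α₁ ‖x‖ / 2)) from EReal.coe_le_coe_iff.2 hreal
  have hT1 : T ≤ 1 := hT.2.le.trans (min_le_right _ _)
  -- Follows from `1 ≤ (1 - T/2)(1 + T)` on `[0, 1]` and `1 + T ≤ eᵀ`.
  have hexp : Real.exp (-T) ≤ 1 - T / 2 := by
    rw [Real.exp_neg, inv_le_comm₀ (Real.exp_pos _) (by linarith)]
    refine le_trans ?_ (Real.add_one_le_exp T)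
    rw [inv_le_iff_one_le_mul₀ (by linarith)]
    nlinarith [hT.1]
  have h₁ := mul_le_mul_of_nonneg_right hexp a.coe_nonneg
  have h₂ := mul_le_mul_of_nonneg_left hlow hT.1.le
  linarith

end DTModel

theorem lemma1 {n p : ℕ} (F : DTModel n p) (D : ℝ) (hD : 0 ≤ D) :
    [F.IsRSSVSR D, F.IsSemiglobalEpsDelta D, F.HasSemiglobalLyapunovFamily D].TFAE := by
  tfae_have 1 → 3 := fun h => h.hasSemiglobalLyapunovFamily hD
  tfae_have 3 → 2 := fun h => h.isSemiglobalEpsDelta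
  tfae_have 2 → 1 := fun h => h.isRSSVSR
  tfae_finish
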